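/- For integers $n\ge 1$ and $\sigma\ge 0$ let $\Sigma=[\sigma]=\{1,\dots,\sigma\}$. For $S=S[1]\cdots S[n]\in\Sigma^n$ let $\mathsf{cyc}(S)=S[2]\cdots S[n]S[1]$, let $\mathsf{cyc}^m$ for $m\in\mathbb Z$ be its iterates, and let $\mathsf{Ham}$ be the Hamming distance on $\Sigma^n$. A randomized function $X\to Y$ is a random variable whose values are functions from $X$ to $Y$. Theorem. For every constant $c\in\mathbb N$ there are constants $C$ and $d$, depending only on $c$, such that for all integers $n\ge 1$, $0\le k\le n$ and $\sigma\ge 0$ there are randomized functions $\mathtt{sk}:\Sigma^n\to\{0,1\}^*$ and $\mathtt{dec}:\{0,1\}^*\times\{0,1\}^*\times\mathbb Z\to\mathbb N$, defined on a common probability space (shared randomness), with the following two properties. (1) (Exact circular $k$-mismatch sketch.) For all $S_1,S_2\in\Sigma^n$ and $m\in\mathbb Z$, with probability at least $1-n^{-c}$: if $\mathsf{Ham}(S_1,\mathsf{cyc}^m(S_2))\le k$, then $\mathtt{dec}(\mathtt{sk}(S_1),\mathtt{sk}(S_2),m)=\mathsf{Ham}(S_1,\mathsf{cyc}^m(S_2))$;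 otherwise $\mathtt{dec}(\mathtt{sk}(S_1),\mathtt{sk}(S_2),m)>k$. (2) (Size $\tilde O(k)$.) For every $S\in\Sigma^n$, with probability at least $1-n^{-c}$, the length of the bit string $\mathtt{sk}(S)$ is at most $C\cdot\max(k,1)\cdot(1+\ln n)^d$. -/

import Mathlib

open MeasureTheory

/-- Strings of length `n` over the alphabet `[σ]`. -/
abbrev Str (n σ : ℕ) : Type := Fin n → Fin σ

/-- Cyclic shift by one position to the left, `S[1]S[2]⋯S[n] ↦ S[2]⋯S[n]S[1]`, as a permutation of
the set of strings, so that `cyc ^ m` makes sense for every integer `m`.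
Here `finRotate n i` is `i + 1` modulo `n`. -/
def cyc (n σ : ℕ) : Equiv.Perm (Str n σ) where
  toFun S := fun i => S (finRotate n i)
  invFun S := fun i => S ((finRotate n).symm i)
  left_inv S := funext fun i => congrArg S ((finRotate n).apply_symm_apply i)
  right_inv S := funext fun i => congrArg S ((finRotate n).symm_apply_apply i)

/-- The Hamming distance between `S₁` and `cyc^m(S₂)`. -/
def hamShift {n σ : ℕ} (S₁ S₂ : Str n σ) (m : ℤ) : ℕ :=
  hammingDist S₁ ((cyc n σ ^ m) S₂)

/-- A randomized function `X → Y`, with `Y` countable: a random variable, defined on the space `Ω`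
of random choices, whose values are functions from `X` to `Y`. -/
def IsRandomizedFunction {Ω : Type} [MeasurableSpace Ω] {X Y : Type} (f : Ω → X → Y) : Prop :=
  ∀ x y, MeasurableSet {ω | f ω x = y}

/-- The randomized functions `sk : [σ]^n → {0,1}^*` and `dec : {0,1}^* × {0,1}^* × ℤ → ℕ`, defined
on a common probability space (the players share their random choices), form an exact circular
`k`-mismatch sketch with success probability at least `1 - δ`. -/
structure IsExactCircularSketch {Ω : Type} [MeasurableSpace Ω] (P : Measure Ω) {n σ : ℕ}
    (k : ℕ) (δ : ℝ) (sk : Ω → Str n σ → List Bool)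
    (dec : Ω → List Bool × List Bool × ℤ → ℕ) : Prop where
  randomized_sk : IsRandomizedFunction sk
  randomized_dec : IsRandomizedFunction dec
  correct : ∀ (S₁ S₂ : Str n σ) (m : ℤ),
    1 - δ ≤ P.real {ω |
      (hamShift S₁ S₂ m ≤ k → dec ω (sk ω S₁, sk ω S₂, m) = hamShift S₁ S₂ m) ∧
      (k < hamShift S₁ S₂ m → k < dec ω (sk ω S₁, sk ω S₂, m))}

/-- The sketch `sk` has size at most `s` (in bits) with probability at least `1 - δ`
on every string. -/
def HasSketchSize {Ω : Type} [MeasurableSpace Ω] (P : Measure Ω) {n σ : ℕ}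
    (s δ : ℝ) (sk : Ω → Str n σ → List Bool) : Prop :=
  ∀ S : Str n σ, 1 - δ ≤ P.real {ω | ((sk ω S).length : ℝ) ≤ s}

/-!
Letters are first relabelled by random elements of a field with polynomially many elements, which
preserves the distance in question. The obstacle is then that the encoders do not know the shift `m`.

For a threshold `K`, let `periodGroup K x` be the group generated by the shifts that change at most
`K` positions of `x`. If `x` and `y` differ in at most `k` positions, these groups interleave along
thresholds that grow by `2 k`, and a chain of subgroups of the group of positions has logarithmic
length. So at one of logarithmically many thresholds the groups of the two strings agree
(`exists_periodGroup_eq`). Fix such a level and let `G` be the common group.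

*Inside `G`.* Write `x = u + v`, where `u` is the restriction of `x` to the cosets of `G` on which `x`
is constant. The part `v` is determined by the changes of `x` along generators of `G`; as
logarithmically many generators with at most `K` changes each suffice, `v` is sent explicitly
(`varyingPart_eq_of_changes_eq`, `exists_encoding_varyingPart`). The part `u` is `G`-invariant, so
only the class of the shift modulo `G` matters for it.

*Modulo `G`.* Shifts outside `G` cause many mismatches. Therefore, if each position `i` is described
by the letters at `i + W a`, for a random pattern `W` of about `n / (10 k)` positions, equal
descriptions occur only at positions that are congruent modulo `G` (`isRare_sample_eq`), while
`k` mismatches spoil at most a tenth of the descriptions. Min-wise sampling from the multiset of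
descriptions picks the same description in both strings with constant probability
(`isRare_not_isFirst_sampleSet`). This yields anchors in both strings that are consistent with the
shift modulo `G` (`isRare_anchor`), and logarithmically many repetitions make this as likely as needed.

*Comparing the invariant parts.* Read from consistent anchors, the invariant parts differ in at most
`k` cosets (`isCosetSparse_invariantPart_sub`). There are few strings supported on `k` cosets, so a
random matrix with `2 k + 3` rows tells the true difference from all others, and from the products of
the matrix with both parts the decoder recovers the difference (`isRare_mulVec_eq_mulVec`). With the
explicit parts this gives the difference of the two strings, hence their distance. If no level and
anchor admit such a difference, the distance exceeds `k`.

All random choices are uniform on finite sets, and probabilities are bounded by counting.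
-/

/-! ### Cyclic shifts and approximate periods -/

/-- The string `x`, indexed by an abelian group, read from position `a` on. -/
def advance {Γ α : Type*} [Add Γ] (a : Γ) (x : Γ → α) : Γ → α := fun i => x (i + a)

section Translate

variable {Γ α : Type*} [AddCommGroup Γ]

lemma advance_advance (a b : Γ) (x : Γ → α) :
    advance a (advance b x) = advance (a + b) x := by
  funext i
  simp [advance, add_assoc]

lemma advance_zero (x : Γ → α) : advance (0 : Γ) x = x := by
  funext i
  simp [advance]

variable [Fintype Γ] [DecidableEq α]

lemma hammingDist_advance (a : Γ) (x y : Γ → α) :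
    hammingDist (advance a x) (advance a y) = hammingDist x y := by
  unfold hammingDist
  refine Finset.card_bij (fun i _ => i + a) ?_ ?_ ?_
  · intro i hi
    simp only [Finset.mem_filter_univ] at hi ⊢
    exact hi
  · intro i _ j _ h
    exact add_right_cancel h
  · intro j hj
    simp only [Finset.mem_filter_univ] at hj
    refine ⟨j - a, ?_, by simp⟩
    rw [Finset.mem_filter_univ]
    simpa only [advance, sub_add_cancel] using hj

/-- The group generated by the `K`-approximate periods of `x`, the shifts that change at most `K`
positions of `x`. -/
def periodGroup (K : ℕ) (x : Γ → α) : AddSubgroup Γ :=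
  AddSubgroup.closure {j | hammingDist (advance j x) x ≤ K}

lemma periodGroup_advance (K : ℕ) (a : Γ) (x : Γ → α) :
    periodGroup K (advance a x) = periodGroup K x := by
  have h (j : Γ) : advance j (advance a x) = advance a (advance j x) := by
    rw [advance_advance, advance_advance, add_comm]
  simp only [periodGroup, h, hammingDist_advance]

lemma periodGroup_le_of_hammingDist_le {K k : ℕ} {x y : Γ → α} (h : hammingDist x y ≤ k) :
    periodGroup K x ≤ periodGroup (K + 2 * k) y := by
  refine AddSubgroup.closure_mono fun j hj => ?_
  simp only [Set.mem_ofPred_eq] at hj ⊢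
  have h1 := hammingDist_triangle (advance j y) (advance j x) y
  have h2 := hammingDist_triangle (advance j x) x y
  rw [hammingDist_advance, hammingDist_comm y x] at h1
  omega

lemma lt_hammingDist_of_notMem_periodGroup {K : ℕ} {x : Γ → α} {j : Γ}
    (h : j ∉ periodGroup K x) : K < hammingDist (advance j x) x := by
  by_contra hj
  exact h (AddSubgroup.subset_closure (not_lt.mp hj))

lemma two_mul_card_le_of_lt {G H : AddSubgroup Γ} (h : G < H) :
    2 * Nat.card G ≤ Nat.card H := by
  obtain ⟨c, hc⟩ := AddSubgroup.card_dvd_of_le h.le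
  have hH : 0 < Nat.card H := Nat.card_pos
  have h0 : c ≠ 0 := by
    rintro rfl
    omega
  have h1 : c ≠ 1 := by
    rintro rfl
    exact h.ne (AddSubgroup.eq_of_le_of_card_ge h.le (by omega))
  have h2 : 2 ≤ c := by omega
  rw [hc, mul_comm 2]
  exact Nat.mul_le_mul_left _ h2

lemma exists_eq_succ_of_monotone {G : ℕ → AddSubgroup Γ} (hG : Monotone G) {l : ℕ}
    (hl : Fintype.card Γ < 2 ^ l) : ∃ t < l, G t = G (t + 1) := by
  by_contra! hne
  have h : ∀ t ≤ l, 2 ^ t ≤ Nat.card (G t) := by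
    intro t
    induction t with
    | zero => exact fun _ => Nat.card_pos
    | succ t ih =>
      intro ht
      have h1 := two_mul_card_le_of_lt ((hG (t.le_add_right 1)).lt_of_ne (hne t ht))
      have h2 := ih (by omega)
      rw [pow_succ]
      omega
  have h1 := h l le_rfl
  have h2 : Nat.card (G l) ≤ Nat.card Γ := AddSubgroup.card_le_card_addGroup _
  rw [Nat.card_eq_fintype_card (α := Γ)] at h2
  omega

/-- Among `2 l` equally spaced thresholds, two close strings have the same group of approximate
periods at one of them: the groups of the two strings interleave, and a chain of subgroups cannot
increase `l` times. -/
lemma exists_periodGroup_eq {k l : ℕ} (K : ℕ) {x y : Γ → α} (h : hammingDist x y ≤ k)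
    (hl : Fintype.card Γ < 2 ^ l) :
    ∃ r < 2 * l, periodGroup (K + 2 * k * r) x = periodGroup (K + 2 * k * r) y := by
  have hmono {a b : ℕ} (hab : a ≤ b) : periodGroup a x ≤ periodGroup b x :=
    AddSubgroup.closure_mono fun j hj => le_trans hj hab
  obtain ⟨t, ht, hEq⟩ := exists_eq_succ_of_monotone
    (G := fun t => periodGroup (K + 2 * k * (2 * t)) x)
    (fun a b hab => hmono (by gcongr)) hl
  have e1 : K + 2 * k * (2 * t + 1) = K + 2 * k * (2 * t) + 2 * k := by ring
  have e2 : K + 2 * k * (2 * (t + 1)) = K + 2 * k * (2 * t + 1) + 2 * k := by ring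
  -- The group of `y` at the odd level is squeezed between the equal groups of `x` next to it.
  refine ⟨2 * t + 1, by omega, le_antisymm ?_ ?_⟩
  · refine le_trans (hmono (b := K + 2 * k * (2 * (t + 1))) (by omega)) ?_
    rw [← hEq, e1]
    exact periodGroup_le_of_hammingDist_le h
  · refine le_trans (periodGroup_le_of_hammingDist_le (k := k) (y := x) ?_) ?_
    · rwa [hammingDist_comm]
    · rw [← e2, ← hEq]
      exact hmono (by omega)

omit [DecidableEq α] in
/-- A largest subset `S` of `J` whose closure has at least `2 ^ |S|` elements generates all of
`closure J`, since an element outside the group generated so far at least doubles it. -/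
lemma exists_small_generating_subset (J : Set Γ) :
    ∃ S : Finset Γ, (S : Set Γ) ⊆ J ∧
      AddSubgroup.closure (S : Set Γ) = AddSubgroup.closure J ∧
      2 ^ S.card ≤ Fintype.card Γ := by
  classical
  let good : Set (Finset Γ) :=
    {S | (S : Set Γ) ⊆ J ∧ 2 ^ S.card ≤ Nat.card (AddSubgroup.closure (S : Set Γ))}
  have hne : good.Nonempty := ⟨∅, by simp, by simp⟩
  obtain ⟨S, ⟨hSJ, hS⟩, hmax⟩ := Set.exists_max_image good Finset.card (Set.toFinite _) hne
  refine ⟨S, hSJ, le_antisymm (AddSubgroup.closure_mono hSJ) ?_, ?_⟩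
  · rw [AddSubgroup.closure_le]
    intro j hj
    by_contra hjS
    have hlt : AddSubgroup.closure (S : Set Γ)
        < AddSubgroup.closure ((insert j S : Finset Γ) : Set Γ) := by
      refine lt_of_le_of_ne (AddSubgroup.closure_mono (by simp)) fun he => hjS ?_
      rw [he]
      exact AddSubgroup.subset_closure (by simp)
    have hjS' : j ∉ S := fun h => hjS (AddSubgroup.subset_closure h)
    have h1 := two_mul_card_le_of_lt hlt
    have h2 := hmax (insert j S) ⟨by
      rw [Finset.coe_insert]
      exact Set.insert_subset hj hSJ, by
      rw [Finset.card_insert_of_notMem hjS', pow_succ]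
      omega⟩
    rw [Finset.card_insert_of_notMem hjS'] at h2
    omega
  · rw [← Nat.card_eq_fintype_card]
    exact hS.trans (AddSubgroup.card_le_card_addGroup _)

end Translate

/-! ### Splitting a string along the cosets of a subgroup -/

section InvariantPart

variable {Γ F : Type*} [AddCommGroup Γ]

open Classical in
/-- The restriction of `x` to the cosets of `G` on which `x` is constant, extended by zero to the
other cosets. -/
noncomputable def invariantPart [Zero F] (G : AddSubgroup Γ) (x : Γ → F) : Γ → F :=
  fun i => if ∀ g ∈ G, x (i + g) = x i then x i else 0

/-- The restriction of `x` to the cosets of `G` on which `x` is not constant, extended by zero. -/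
noncomputable def varyingPart [AddGroup F] (G : AddSubgroup Γ) (x : Γ → F) : Γ → F :=
  x - invariantPart G x

lemma invariantPart_advance [Zero F] (G : AddSubgroup Γ) (a : Γ) (x : Γ → F) :
    invariantPart G (advance a x) = advance a (invariantPart G x) := by
  classical
  funext i
  simp only [invariantPart, advance]
  exact if_congr (forall₂_congr fun g _ => by rw [add_right_comm]) rfl rfl

lemma varyingPart_advance [AddGroup F] (G : AddSubgroup Γ) (a : Γ) (x : Γ → F) :
    varyingPart G (advance a x) = advance a (varyingPart G x) := by
  rw [varyingPart, invariantPart_advance]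
  rfl

lemma invariantPart_add_mem [Zero F] (G : AddSubgroup Γ) (x : Γ → F) {g : Γ} (hg : g ∈ G) (i : Γ) :
    invariantPart G x (i + g) = invariantPart G x i := by
  have hiff : (∀ g' ∈ G, x (i + g + g') = x (i + g)) ↔ ∀ g' ∈ G, x (i + g') = x i := by
    constructor
    · intro h g' hg'
      have h1 := h (g' - g) (G.sub_mem hg' hg)
      have h2 := h (-g) (G.neg_mem hg)
      rw [show i + g + (g' - g) = i + g' by abel] at h1
      rw [show i + g + -g = i by abel] at h2
      rw [h1, h2]
    · intro h g' hg'
      rw [add_assoc, h _ (G.add_mem hg hg'), h _ hg]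
  unfold invariantPart
  by_cases h : ∀ g' ∈ G, x (i + g') = x i
  · rw [if_pos (hiff.mpr h), if_pos h, h g hg]
  · rw [if_neg (mt hiff.mp h), if_neg h]

lemma exists_ne_of_invariantPart_ne [Zero F] {G : AddSubgroup Γ} {x y : Γ → F} {i : Γ}
    (h : invariantPart G x i ≠ invariantPart G y i) : ∃ g ∈ G, x (i + g) ≠ y (i + g) := by
  classical
  by_contra! hxy
  apply h
  have h0 : x i = y i := by simpa using hxy 0 G.zero_mem
  have hiff : (∀ g ∈ G, x (i + g) = x i) ↔ ∀ g ∈ G, y (i + g) = y i :=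
    forall₂_congr fun g hg => by rw [hxy g hg, h0]
  unfold invariantPart
  rw [if_congr hiff h0 rfl]

/-- The part of a string off the constant cosets of `G` is determined by its changes along
generators of `G`: the set of positions where two such strings agree contains all the changes, hence
is invariant under the generators and meets every coset with a change. -/
lemma varyingPart_eq_of_changes_eq [AddGroup F] {S : Set Γ} {x y : Γ → F}
    (hx : ∀ j ∈ S, ∀ p, x (p + j) ≠ x p → y p = x p ∧ y (p + j) = x (p + j))
    (hy : ∀ j ∈ S, ∀ p, y (p + j) ≠ y p → x p = y p ∧ x (p + j) = y (p + j)) :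
    varyingPart (AddSubgroup.closure S) x = varyingPart (AddSubgroup.closure S) y := by
  classical
  -- The set of positions where `x` and `y` agree is invariant under the generators.
  have hE : ∀ g ∈ AddSubgroup.closure S, ∀ p, x (p + g) = y (p + g) ↔ x p = y p := by
    intro g hg
    induction hg using AddSubgroup.closure_induction with
    | mem j hj =>
      intro p
      by_cases h1 : x (p + j) = x p
      · by_cases h2 : y (p + j) = y p
        · rw [h1, h2]
        · have := hy j hj p h2
          simp [this.1, this.2]
      · have := hx j hj p h1
        simp [this.1, this.2]
    | zero => simp
    | add a b _ _ iha ihb =>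
      intro p
      rw [← add_assoc, ihb, iha]
    | neg a _ iha =>
      intro p
      have := iha (p + -a)
      rw [neg_add_cancel_right] at this
      exact this.symm
  -- A coset with a position of disagreement contains no change.
  have key : ∀ {u v : Γ → F} (i : Γ),
      (∀ g ∈ AddSubgroup.closure S, ∀ p, u (p + g) = v (p + g) ↔ u p = v p) →
      (∀ j ∈ S, ∀ p, u (p + j) ≠ u p → v p = u p ∧ v (p + j) = u (p + j)) → u i ≠ v i →
      ∀ g ∈ AddSubgroup.closure S, u (i + g) = u i := by
    intro u v i hE hu hi g hg
    induction hg using AddSubgroup.closure_induction_right with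
    | zero => simp
    | add_right a ha j hj ih =>
      rw [← ih]
      by_contra hne
      rw [← add_assoc] at hne
      exact hi ((hE a ha i).mp (hu j hj _ hne).1.symm)
    | add_neg_cancel a ha j hj ih =>
      rw [← ih]
      by_contra hne
      have h1 := hu j hj (i + (a + -j)) (by
        rw [show i + (a + -j) + j = i + a by abel]
        exact fun h => hne h.symm)
      rw [show i + (a + -j) + j = i + a by abel] at h1
      exact hi ((hE a ha i).mp h1.2.symm)
  funext i
  simp only [varyingPart, invariantPart, Pi.sub_apply]
  by_cases hi : x i = y i
  · have hiff : (∀ g ∈ AddSubgroup.closure S, x (i + g) = x i) ↔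
        ∀ g ∈ AddSubgroup.closure S, y (i + g) = y i :=
      forall₂_congr fun g hg => by rw [(hE g hg i).mpr hi, hi]
    rw [if_congr hiff hi rfl, hi]
  · rw [if_pos (key i hE hx hi),
      if_pos (key i (fun g hg p => by rw [eq_comm, hE g hg p, eq_comm]) hy (Ne.symm hi))]
    simp

end InvariantPart

/-! ### Sparse invariant strings and the encoding of the varying part -/

/-- The string `v` is `G`-invariant and supported on at most `k` cosets of `G`. -/
def IsCosetSparse {Γ F : Type*} [AddCommGroup Γ] [Zero F] (G : AddSubgroup Γ) (k : ℕ)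
    (v : Γ → F) : Prop :=
  (∀ g ∈ G, ∀ i, v (i + g) = v i) ∧
    ∃ P : Finset Γ, P.card ≤ k ∧ ∀ i, v i ≠ 0 → ∃ p ∈ P, i - p ∈ G

lemma exists_enumeration {X : Type*} (P : Finset X) {k : ℕ} (h : P.card ≤ k) :
    ∃ f : Fin k → Option X, ∀ p, p ∈ P ↔ ∃ e, f e = some p := by
  refine ⟨fun e => P.toList[(e : ℕ)]?, fun p => ?_⟩
  rw [← Finset.mem_toList, List.mem_iff_getElem?]
  constructor
  · rintro ⟨i, hi⟩
    obtain ⟨hlt, -⟩ := List.getElem?_eq_some_iff.mp hi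
    rw [Finset.length_toList] at hlt
    exact ⟨⟨i, by omega⟩, hi⟩
  · rintro ⟨e, he⟩
    exact ⟨e, he⟩

section Sparse

variable {Γ F : Type*} [AddCommGroup Γ] [Fintype Γ]

lemma ncard_isCosetSparse_le [Zero F] [Fintype F] (G : AddSubgroup Γ) (k : ℕ) :
    {v : Γ → F | IsCosetSparse G k v}.ncard ≤ (Fintype.card Γ * Fintype.card F + 1) ^ k := by
  classical
  let spread (f : Fin k → Option (Γ × F)) : Γ → F := fun i =>
    if h : ∃ a, ∃ e p, f e = some (p, a) ∧ i - p ∈ G then h.choose else 0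
  have hsub : {v : Γ → F | IsCosetSparse G k v} ⊆ Set.range spread := by
    rintro v ⟨hv, P, hP, hsupp⟩
    obtain ⟨f, hf⟩ := exists_enumeration (P.image fun p => (p, v p))
      (Finset.card_image_le.trans hP)
    refine ⟨f, funext fun i => ?_⟩
    have hval : ∀ a, (∃ e p, f e = some (p, a) ∧ i - p ∈ G) → a = v i := by
      rintro a ⟨e, p, hep, hip⟩
      have hmem := (hf (p, a)).mpr ⟨e, hep⟩
      simp only [Finset.mem_image, Prod.mk.injEq] at hmem
      obtain ⟨p', -, rfl, rfl⟩ := hmem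
      rw [← hv _ hip p', add_sub_cancel]
    simp only [spread]
    split_ifs with h
    · exact hval _ h.choose_spec
    · by_contra hi
      obtain ⟨p, hp, hip⟩ := hsupp i (Ne.symm hi)
      obtain ⟨e, he⟩ := (hf (p, v p)).mp (Finset.mem_image_of_mem _ hp)
      exact h ⟨v p, e, p, he, hip⟩
  calc _ ≤ (Set.range spread).ncard := Set.ncard_le_ncard hsub (Set.toFinite _)
    _ ≤ (Set.univ : Set (Fin k → Option (Γ × F))).ncard := by
        rw [← Set.image_univ]
        exact Set.ncard_image_le (Set.toFinite _)
    _ = _ := by simp [Set.ncard_univ, Nat.card_eq_fintype_card]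

/-- A coset on which the invariant parts of two strings differ contains a mismatch. -/
lemma isCosetSparse_invariantPart_sub [AddGroup F] [DecidableEq F] (G : AddSubgroup Γ) {k : ℕ}
    {x y : Γ → F} (h : hammingDist x y ≤ k) :
    IsCosetSparse G k (invariantPart G x - invariantPart G y) := by
  refine ⟨fun g hg i => ?_, Finset.univ.filter fun i => x i ≠ y i, h, fun i hi => ?_⟩
  · simp only [Pi.sub_apply, invariantPart_add_mem G _ hg]
  · obtain ⟨g, hg, hne⟩ := exists_ne_of_invariantPart_ne (sub_ne_zero.mp hi)
    exact ⟨i + g, by simpa using hne, by simpa using hg⟩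

/-- The group of approximate periods of a string together with its varying part can be encoded by
few generators and the list of all changes along them. -/
lemma exists_encoding_varyingPart [AddGroup F] [DecidableEq F] {K l M : ℕ}
    (hl : Fintype.card Γ < 2 ^ l) (hM : l * K ≤ M) :
    ∃ (enc : (Γ → F) → (Fin l → Option Γ) × (Fin M → Option (Γ × Γ × F × F)))
      (dec : (Fin l → Option Γ) × (Fin M → Option (Γ × Γ × F × F)) → AddSubgroup Γ × (Γ → F)),
      ∀ x, dec (enc x) = (periodGroup K x, varyingPart (periodGroup K x) x) := by
  classical
  have key (x : Γ → F) : ∃ (S : Finset Γ)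
      (d : (Fin l → Option Γ) × (Fin M → Option (Γ × Γ × F × F))),
      AddSubgroup.closure (S : Set Γ) = periodGroup K x ∧
      (∀ j, j ∈ S ↔ ∃ e, d.1 e = some j) ∧
      ∀ j p a b, (j ∈ S ∧ x (p + j) ≠ x p ∧ x p = a ∧ x (p + j) = b) ↔
        ∃ e, d.2 e = some (j, p, a, b) := by
    obtain ⟨S, hSJ, hS, hcard⟩ :=
      exists_small_generating_subset {j | hammingDist (advance j x) x ≤ K}
    have hSl : S.card ≤ l := (Nat.pow_lt_pow_iff_right (by norm_num)).mp (hcard.trans_lt hl) |>.le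
    obtain ⟨f, hf⟩ := exists_enumeration S hSl
    obtain ⟨g, hg⟩ := exists_enumeration (k := M)
      (S.biUnion fun j => (Finset.univ.filter fun p => x (p + j) ≠ x p).image
        fun p => (j, p, x p, x (p + j)))
      ((Finset.card_biUnion_le_card_mul _ _ K fun j hj =>
        Finset.card_image_le.trans (hSJ hj)).trans ((Nat.mul_le_mul_right K hSl).trans hM))
    refine ⟨S, (f, g), hS, hf, fun j p a b => ?_⟩
    rw [← hg]
    simp only [Finset.mem_biUnion, Finset.mem_image, Finset.mem_filter_univ, Prod.mk.injEq]
    constructor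
    · rintro ⟨hj, hne, rfl, rfl⟩
      exact ⟨j, hj, p, hne, rfl, rfl, rfl, rfl⟩
    · rintro ⟨j, hj, p, hne, rfl, rfl, rfl, rfl⟩
      exact ⟨hj, hne, rfl, rfl⟩
  choose S enc hS h1 h2 using key
  refine ⟨enc, fun e => (fun x => (periodGroup K x, varyingPart (periodGroup K x) x))
    (Function.invFun enc e), fun y => ?_⟩
  have hxy : enc (Function.invFun enc (enc y)) = enc y := Function.invFun_eq ⟨y, rfl⟩
  set x := Function.invFun enc (enc y)
  have hSS : S x = S y := by
    ext j
    rw [h1, h1, hxy]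
  have hG : periodGroup K x = periodGroup K y := by rw [← hS, ← hS, hSS]
  refine Prod.ext hG ?_
  change varyingPart (periodGroup K x) x = varyingPart (periodGroup K y) y
  rw [← hG, ← hS x]
  refine varyingPart_eq_of_changes_eq (fun j hj p hne => ?_) (fun j hj p hne => ?_)
  · have h := (h2 x j p _ _).mp ⟨hj, hne, rfl, rfl⟩
    rw [hxy, ← h2] at h
    exact h.2.2
  · rw [hSS] at hj
    have h := (h2 y j p _ _).mp ⟨hj, hne, rfl, rfl⟩
    rw [← hxy, ← h2] at h
    exact h.2.2

end Sparse

/-! ### Rare events under a uniformly random choice -/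

/-- A uniformly random element of the finite type `α` lies in `B` with probability at most `1 / N`. -/
def IsRare {α : Type*} (N : ℕ) (B : Set α) : Prop :=
  B.ncard * N ≤ Nat.card α

section Rare

variable {α β ι : Type*}

lemma IsRare.mono [Finite α] {N : ℕ} {B B' : Set α} (h : IsRare N B') (hB : B ⊆ B') :
    IsRare N B :=
  (Nat.mul_le_mul_right N (Set.ncard_le_ncard hB (Set.toFinite _))).trans h

lemma IsRare.of_le {N N' : ℕ} {B : Set α} (h : IsRare N' B) (hN : N ≤ N') : IsRare N B :=
  (Nat.mul_le_mul_left _ hN).trans h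

lemma ncard_biUnion_mul_le [Finite α] {s : Set ι} (hs : s.Finite) (B : ι → Set α) {M N : ℕ}
    (h : ∀ i ∈ s, (B i).ncard * N ≤ M) : (⋃ i ∈ s, B i).ncard * N ≤ s.ncard * M := by
  induction s, hs using Set.Finite.induction_on with
  | empty => simp
  | @insert a s ha hs ih =>
    rw [Set.biUnion_insert, Set.ncard_insert_of_notMem ha hs]
    have h1 := Set.ncard_union_le (B a) (⋃ i ∈ s, B i)
    have h2 := ih fun i hi => h i (Set.mem_insert_of_mem a hi)
    have h3 := h a (Set.mem_insert a s)
    nlinarith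

lemma IsRare.union [Finite α] {N : ℕ} {B B' : Set α} (h : IsRare (2 * N) B)
    (h' : IsRare (2 * N) B') : IsRare N (B ∪ B') := by
  have h1 := Set.ncard_union_le B B'
  unfold IsRare at *
  nlinarith

lemma IsRare.of_slices [Finite α] [Finite β] {N : ℕ} {B : Set (α × β)}
    (h : ∀ a, IsRare N {b | (a, b) ∈ B}) : IsRare N B := by
  have := Fintype.ofFinite α
  have hB : B.ncard = ∑ a, {b | (a, b) ∈ B}.ncard := by
    rw [← Nat.card_coe_set_eq]
    refine (Nat.card_congr (Equiv.subtypeProdEquivSigmaSubtype fun a b => (a, b) ∈ B)).trans ?_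
    rw [Nat.card_sigma]
    rfl
  unfold IsRare at *
  rw [hB, Finset.sum_mul, Nat.card_prod]
  calc _ ≤ ∑ _a : α, Nat.card β := Finset.sum_le_sum fun a _ => h a
    _ = _ := by simp

lemma IsRare.fst [Finite α] [Finite β] {N : ℕ} {B : Set α} (h : IsRare N B) :
    IsRare N {p : α × β | p.1 ∈ B} := by
  have hB : {p : α × β | p.1 ∈ B} = B ×ˢ Set.univ := by
    ext
    simp
  unfold IsRare at *
  rw [hB, Set.ncard_prod, Set.ncard_univ, Nat.card_prod, mul_right_comm]
  exact Nat.mul_le_mul_right _ h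

lemma IsRare.snd [Finite α] [Finite β] {N : ℕ} {B : Set β} (h : IsRare N B) :
    IsRare N {p : α × β | p.2 ∈ B} :=
  IsRare.of_slices fun _ => h

lemma ncard_pi_const [Finite α] (w : ℕ) (B : Set α) :
    {f : Fin w → α | ∀ a, f a ∈ B}.ncard = B.ncard ^ w := by
  rw [← Nat.card_coe_set_eq, ← Nat.card_coe_set_eq]
  refine (Nat.card_congr (Equiv.subtypePiEquivPi (p := fun _ a => a ∈ B))).trans ?_
  rw [Nat.card_fun, Nat.card_fin]

lemma IsRare.pi_const [Finite α] {N : ℕ} {B : Set α} (h : IsRare N B) (w : ℕ) :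
    IsRare (N ^ w) {f : Fin w → α | ∀ a, f a ∈ B} := by
  unfold IsRare at *
  rw [ncard_pi_const, ← mul_pow]
  refine (Nat.pow_le_pow_left h w).trans ?_
  rw [Nat.card_fun, Nat.card_fin]

lemma isRare_eq_zero_of_surjective {A B : Type*} [AddGroup A] [AddGroup B] {φ : A →+ B}
    (hφ : Function.Surjective φ) : IsRare (Nat.card B) {x | φ x = 0} := by
  have h := φ.ker.card_mul_index
  rw [AddSubgroup.index_ker, AddMonoidHom.range_eq_top.mpr hφ, AddSubgroup.card_top] at h
  exact h.le

/-- A uniformly random matrix over a finite field does not annihilate a given nonzero vector, except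
with probability `q ^ (-s)`, where `s` is the number of rows. -/
lemma isRare_mulVec_eq_zero {Γ F : Type*} [Fintype Γ] [Field F] [Fintype F] (s : ℕ) {v : Γ → F}
    (hv : v ≠ 0) :
    IsRare (Fintype.card F ^ s) {A : Matrix (Fin s) Γ F | A.mulVec v = 0} := by
  classical
  obtain ⟨i₀, hi₀⟩ := Function.ne_iff.mp hv
  have hφ : Function.Surjective
      (Matrix.mulVec.addMonoidHomLeft v : Matrix (Fin s) Γ F →+ (Fin s → F)) := by
    intro b
    refine ⟨Matrix.of fun a => Pi.single i₀ (b a / v i₀), funext fun a => ?_⟩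
    have : v i₀ ≠ 0 := hi₀
    simp [Matrix.mulVec, this]
  have h := isRare_eq_zero_of_surjective hφ
  rwa [Nat.card_fun, Nat.card_fin, Nat.card_eq_fintype_card] at h

/-- A uniformly random function separates two given points, except with probability `1 / q`. -/
lemma isRare_apply_eq {F : Type*} [AddCommGroup F] {a b : α} (hab : a ≠ b) :
    IsRare (Nat.card F) {h : α → F | h a = h b} := by
  classical
  have hφ : Function.Surjective (Pi.evalAddMonoidHom (fun _ : α => F) a -
      Pi.evalAddMonoidHom (fun _ : α => F) b) := fun c =>
    ⟨Pi.single a c, by simp [Pi.single_eq_of_ne hab.symm]⟩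
  convert isRare_eq_zero_of_surjective hφ using 3
  simp [sub_eq_zero]

/-- A random matrix tells a given vector from all vectors of a small set, as soon as its number of
rows exceeds the logarithm of the size of the set. Here this holds for a family of vectors, each
compared with all coset-sparse strings. -/
lemma isRare_mulVec_eq_mulVec {Γ F : Type*} [AddCommGroup Γ] [Fintype Γ] [Field F] [Fintype F]
    [Fintype ι] (G : ι → AddSubgroup Γ) (u : ι → Γ → F) {k s N : ℕ}
    (hN : N * (Fintype.card ι * (Fintype.card Γ * Fintype.card F + 1) ^ k) ≤ Fintype.card F ^ s) :
    IsRare N {A : Matrix (Fin s) Γ F |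
      ∃ t v, IsCosetSparse (G t) k v ∧ A.mulVec v = A.mulVec (u t) ∧ v ≠ u t} := by
  classical
  set B : Set (Matrix (Fin s) Γ F) := ⋃ t ∈ (Set.univ : Set ι),
    ⋃ v ∈ {v : Γ → F | IsCosetSparse (G t) k v ∧ v ≠ u t}, {A | A.mulVec (v - u t) = 0} with hB
  refine IsRare.mono (B' := B) ?_ ?_
  · have h1 : B.ncard * Fintype.card F ^ s ≤ (Set.univ : Set ι).ncard *
        ((Fintype.card Γ * Fintype.card F + 1) ^ k * Nat.card (Matrix (Fin s) Γ F)) := by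
      refine ncard_biUnion_mul_le (Set.toFinite _) _ fun t _ => ?_
      refine (ncard_biUnion_mul_le (Set.toFinite _) _ fun v hv =>
        isRare_mulVec_eq_zero s (sub_ne_zero.mpr hv.2)).trans ?_
      refine Nat.mul_le_mul_right _ (le_trans ?_ (ncard_isCosetSparse_le (G t) k))
      exact Set.ncard_le_ncard (fun v hv => hv.1) (Set.toFinite _)
    rw [Set.ncard_univ, Nat.card_eq_fintype_card] at h1
    have hq : 0 < Fintype.card F ^ s := pow_pos Fintype.card_pos s
    refine Nat.le_of_mul_le_mul_right (c := Fintype.card F ^ s) ?_ hq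
    calc _ = N * (B.ncard * Fintype.card F ^ s) := by ring
      _ ≤ N * _ := Nat.mul_le_mul_left N h1
      _ = Nat.card (Matrix (Fin s) Γ F) *
          (N * (Fintype.card ι * (Fintype.card Γ * Fintype.card F + 1) ^ k)) := by ring
      _ ≤ _ := Nat.mul_le_mul_left _ hN
  · rintro A ⟨t, v, hv, hA, hne⟩
    refine Set.mem_biUnion (Set.mem_univ t) (Set.mem_biUnion (x := v) ⟨hv, hne⟩ ?_)
    rw [Set.mem_ofPred_eq, Matrix.mulVec_sub, hA, sub_self]

end Rare

/-! ### Anchors: consistent sampling of positions -/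

section MinHash

variable {D : Type*} [Fintype D]

/-- The element `d` comes first in `X` in the order given by the enumeration `π`. -/
def IsFirst (π : D ≃ Fin (Fintype.card D)) (X : Finset D) (d : D) : Prop :=
  d ∈ X ∧ ∀ d' ∈ X, π d ≤ π d'

lemma exists_isFirst (π : D ≃ Fin (Fintype.card D)) {X : Finset D} (hX : X.Nonempty) :
    ∃ d, IsFirst π X d :=
  X.exists_min_image π hX

lemma IsFirst.eq {π : D ≃ Fin (Fintype.card D)} {X : Finset D} {d d' : D} (h : IsFirst π X d)
    (h' : IsFirst π X d') : d = d' :=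
  π.injective (le_antisymm (h.2 _ h'.1) (h'.2 _ h.1))

/-- Under a random enumeration, each element of `X` is equally likely to come first. -/
lemma ncard_isFirst_mul_card {X : Finset D} {d : D} (hd : d ∈ X) :
    {π | IsFirst π X d}.ncard * X.card = Nat.card (D ≃ Fin (Fintype.card D)) := by
  classical
  -- Precomposing with the transposition of `d` and `d'` exchanges the two events.
  have hsymm : ∀ d' ∈ X, {π | IsFirst π X d'}.ncard = {π | IsFirst π X d}.ncard := by
    intro d' hd'
    have hmem : ∀ e, e ∈ X → Equiv.swap d d' e ∈ X := by
      intro e he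
      rw [Equiv.swap_apply_def]
      split_ifs <;> assumption
    have hmap : ∀ a b (π : D ≃ Fin (Fintype.card D)), Equiv.swap d d' a = b → b ∈ X → a ∈ X →
        IsFirst π X b → IsFirst ((Equiv.swap d d').trans π) X a := by
      intro a b π hab _ ha hπ
      refine ⟨ha, fun e he => ?_⟩
      simp only [Equiv.trans_apply, hab]
      exact hπ.2 _ (hmem e he)
    refine Set.ncard_congr (fun π _ => (Equiv.swap d d').trans π) ?_ ?_ ?_
    · intro π hπ
      exact hmap d d' π (Equiv.swap_apply_left d d') hd' hd hπ
    · intro π π' _ _ h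
      ext e
      have := DFunLike.congr_fun h (Equiv.swap d d' e)
      simp only [Equiv.trans_apply, Equiv.swap_apply_self] at this
      rw [this]
    · intro π hπ
      refine ⟨(Equiv.swap d d').trans π, hmap d' d π (Equiv.swap_apply_right d d') hd hd' hπ, ?_⟩
      ext e
      simp
  have hunion : (Set.univ : Set (D ≃ Fin (Fintype.card D))) =
      ⋃ d' ∈ (X : Set D), {π | IsFirst π X d'} := by
    refine (Set.eq_univ_of_forall fun π => ?_).symm
    obtain ⟨d', hd'⟩ := exists_isFirst π ⟨d, hd⟩
    exact Set.mem_biUnion (Finset.mem_coe.mpr hd'.1) hd'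
  rw [← Set.ncard_univ, hunion, Set.Finite.ncard_biUnion X.finite_toSet (fun _ _ => Set.toFinite _)
    (fun a _ b _ hab => Set.disjoint_left.mpr fun π h h' => hab (h.eq h')),
    finsum_mem_coe_finset, Finset.sum_congr rfl hsymm, Finset.sum_const, smul_eq_mul, mul_comm]

/-- If two sets overlap substantially, then the same element comes first in both under most
enumerations. -/
lemma isRare_not_isFirst [DecidableEq D] {X Y : Finset D} {N : ℕ} (hX : X.Nonempty)
    (h : ((X ∪ Y) \ (X ∩ Y)).card * N ≤ (X ∪ Y).card) :
    IsRare N {π | ¬∃ d, IsFirst π X d ∧ IsFirst π Y d} := by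
  set U := X ∪ Y with hU
  set V := U \ (X ∩ Y) with hV
  have hUne : U.Nonempty := hX.mono Finset.subset_union_left
  -- The first element of the union decides: if it is common to both sets, it comes first in both.
  have hsub : {π | ¬∃ d, IsFirst π X d ∧ IsFirst π Y d} ⊆ ⋃ d ∈ (V : Set D), {π | IsFirst π U d} := by
    intro π hπ
    obtain ⟨d, hd⟩ := exists_isFirst π hUne
    refine Set.mem_biUnion (x := d) ?_ hd
    rw [Finset.mem_coe, hV, Finset.mem_sdiff]
    refine ⟨hd.1, fun hXY => hπ ⟨d, ?_, ?_⟩⟩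
    · exact ⟨Finset.mem_of_mem_inter_left hXY, fun e he => hd.2 e (Finset.mem_union_left _ he)⟩
    · exact ⟨Finset.mem_of_mem_inter_right hXY, fun e he => hd.2 e (Finset.mem_union_right _ he)⟩
  refine IsRare.mono ?_ hsub
  have h1 := ncard_biUnion_mul_le (N := U.card) (M := Nat.card (D ≃ Fin (Fintype.card D)))
    V.finite_toSet (fun d => {π | IsFirst π U d})
    (fun d hd => (ncard_isFirst_mul_card (Finset.sdiff_subset (Finset.mem_coe.mp hd))).le)
  rw [Set.ncard_coe_finset] at h1
  have hpos : 0 < U.card := hUne.card_pos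
  unfold IsRare
  refine Nat.le_of_mul_le_mul_right ?_ hpos
  calc _ = (⋃ d ∈ (V : Set D), {π | IsFirst π U d}).ncard * U.card * N := by ring
    _ ≤ V.card * Nat.card (D ≃ Fin (Fintype.card D)) * N := Nat.mul_le_mul_right _ h1
    _ = Nat.card (D ≃ Fin (Fintype.card D)) * (V.card * N) := by ring
    _ ≤ _ := Nat.mul_le_mul_left _ h

end MinHash

section Anchor

variable {Γ F : Type*} [AddCommGroup Γ] {w : ℕ}

/-- The letters of `x` at the positions of the pattern `W` placed at `i`. -/
def sample (W : Fin w → Γ) (x : Γ → F) (i : Γ) : Fin w → F := fun a => x (i + W a)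

lemma sample_advance (W : Fin w → Γ) (a : Γ) (x : Γ → F) (i : Γ) :
    sample W (advance a x) i = sample W x (i + a) := by
  funext b
  simp [sample, advance, add_right_comm]

variable [Fintype Γ] [Fintype F]

/-- The multiset of all samples of `x`; the copies of a sample are told apart by a counter. -/
noncomputable def sampleSet (W : Fin w → Γ) (x : Γ → F) :
    Finset ((Fin w → F) × Fin (Fintype.card Γ)) := by
  classical
  exact Finset.univ.filter fun d => (d.2 : ℕ) < (Finset.univ.filter fun i => sample W x i = d.1).card

/-- A position whose sample comes first, with the counters, in the order `π`. -/
noncomputable def anchor (W : Fin w → Γ)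
    (π : (Fin w → F) × Fin (Fintype.card Γ) ≃
      Fin (Fintype.card ((Fin w → F) × Fin (Fintype.card Γ))))
    (x : Γ → F) : Γ :=
  Classical.epsilon fun i => ∃ d, IsFirst π (sampleSet W x) d ∧ sample W x i = d.1

lemma sample_anchor {W : Fin w → Γ}
    {π : (Fin w → F) × Fin (Fintype.card Γ) ≃
      Fin (Fintype.card ((Fin w → F) × Fin (Fintype.card Γ)))}
    {x : Γ → F} {d : (Fin w → F) × Fin (Fintype.card Γ)} (hd : IsFirst π (sampleSet W x) d) :
    sample W x (anchor W π x) = d.1 := by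
  classical
  have hne : ∃ i, ∃ d, IsFirst π (sampleSet W x) d ∧ sample W x i = d.1 := by
    have h := hd.1
    simp only [sampleSet, Finset.mem_filter_univ] at h
    obtain ⟨i, hi⟩ := Finset.card_pos.mp (Nat.zero_lt_of_lt h)
    exact ⟨i, d, hd, by simpa using hi⟩
  obtain ⟨d', hd', h⟩ := Classical.epsilon_spec hne
  rw [hd.eq hd']
  exact h

lemma sampleSet_advance (W : Fin w → Γ) (a : Γ) (x : Γ → F) :
    sampleSet W (advance a x) = sampleSet W x := by
  classical
  unfold sampleSet
  refine Finset.filter_congr fun d _ => ?_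
  simp only [sample_advance]
  rw [Finset.card_equiv (Equiv.addRight a) (t := Finset.univ.filter fun i => sample W x i = d.1)]
  intro i
  simp

lemma card_sampleSet (W : Fin w → Γ) (x : Γ → F) :
    (sampleSet W x).card = Fintype.card Γ := by
  classical
  unfold sampleSet
  rw [Finset.card_filter, Fintype.sum_prod_type]
  simp_rw [← Finset.card_filter, Fin.card_filter_val_lt]
  rw [← Finset.card_univ (α := Γ)]
  conv_rhs => rw [Finset.card_eq_sum_card_fiberwise (s := Finset.univ) (f := sample W x)
    (t := Finset.univ) (fun _ _ => Finset.mem_coe.mpr (Finset.mem_univ _))]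
  exact Finset.sum_congr rfl fun c _ => min_eq_right (Finset.card_le_univ _)

omit [Fintype F] in
lemma card_sample_ne_le [DecidableEq F] (W : Fin w → Γ) (x y : Γ → F) :
    (Finset.univ.filter fun i => sample W x i ≠ sample W y i).card ≤ w * hammingDist x y := by
  classical
  calc _ ≤ (Finset.univ.biUnion fun a => Finset.univ.filter fun i =>
        advance (W a) x i ≠ advance (W a) y i).card := by
        refine Finset.card_le_card fun i hi => ?_
        rw [Finset.mem_filter_univ] at hi
        obtain ⟨a, ha⟩ := Function.ne_iff.mp hi
        refine Finset.mem_biUnion.mpr ⟨a, Finset.mem_univ _, ?_⟩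
        rw [Finset.mem_filter_univ]
        exact ha
    _ ≤ (Finset.univ : Finset (Fin w)).card * hammingDist x y :=
        Finset.card_biUnion_le_card_mul _ _ _ fun a _ => (hammingDist_advance (W a) x y).le
    _ = _ := by simp

lemma card_sampleSet_sdiff_le [DecidableEq F] (W : Fin w → Γ) (x y : Γ → F) :
    (sampleSet W x \ sampleSet W y).card ≤ w * hammingDist x y := by
  classical
  refine le_trans ?_ (card_sample_ne_le W x y)
  unfold sampleSet
  rw [← Finset.filter_and_not, Finset.card_filter, Fintype.sum_prod_type,
    Finset.card_eq_sum_card_fiberwise (f := sample W x) (t := Finset.univ)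
      (fun _ _ => Finset.mem_coe.mpr (Finset.mem_univ _))]
  simp_rw [← Finset.card_filter]
  refine Finset.sum_le_sum fun c _ => ?_
  set a := (Finset.univ.filter fun i => sample W x i = c).card with ha
  set b := (Finset.univ.filter fun i => sample W y i = c).card with hb
  have h1 : (Finset.univ.filter fun t : Fin (Fintype.card Γ) => (t : ℕ) < a ∧ ¬(t : ℕ) < b).card
      ≤ (Finset.Ico b a).card := by
    refine Finset.card_le_card_of_injOn Fin.val (fun t ht => ?_) (Fin.val_injective.injOn)
    rw [Finset.mem_coe, Finset.mem_filter_univ] at ht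
    rw [Finset.mem_coe, Finset.mem_Ico]
    omega
  have h2 : a ≤ b + ((Finset.univ.filter fun i => sample W x i ≠ sample W y i).filter
      fun i => sample W x i = c).card := by
    rw [ha, hb]
    refine le_trans (Finset.card_le_card fun i hi => ?_) (Finset.card_union_le _ _)
    rw [Finset.mem_filter_univ] at hi
    rw [Finset.mem_union, Finset.mem_filter_univ, Finset.mem_filter, Finset.mem_filter_univ]
    by_cases h : sample W y i = c
    · exact Or.inl h
    · exact Or.inr ⟨fun he => h (he ▸ hi), hi⟩
  rw [Nat.card_Ico] at h1
  omega

/-- If two strings have few mismatches, then their sample multisets overlap substantially. -/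
lemma isRare_not_isFirst_sampleSet [DecidableEq F] [Nonempty Γ] {k : ℕ} {x y : Γ → F}
    (h : hammingDist x y ≤ k) (hw : 10 * k * w ≤ Fintype.card Γ) (W : Fin w → Γ) :
    IsRare 5 {π | ¬∃ d, IsFirst π (sampleSet W x) d ∧ IsFirst π (sampleSet W y) d} := by
  classical
  have hn : 0 < Fintype.card Γ := Fintype.card_pos
  refine isRare_not_isFirst (Finset.card_pos.mp (by rwa [card_sampleSet])) ?_
  have h1 := card_sampleSet_sdiff_le W x y
  have h2 := card_sampleSet_sdiff_le W y x
  rw [hammingDist_comm] at h2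
  have h3 : w * hammingDist x y ≤ w * k := Nat.mul_le_mul_left w h
  have h4 : ((sampleSet W x ∪ sampleSet W y) \ (sampleSet W x ∩ sampleSet W y)).card ≤
      (sampleSet W x \ sampleSet W y).card + (sampleSet W y \ sampleSet W x).card := by
    refine le_trans (Finset.card_le_card fun d hd => ?_) (Finset.card_union_le _ _)
    simp only [Finset.mem_sdiff, Finset.mem_union, Finset.mem_inter] at hd ⊢
    tauto
  have h5 : (sampleSet W x).card ≤ (sampleSet W x ∪ sampleSet W y).card :=
    Finset.card_le_card Finset.subset_union_left
  rw [card_sampleSet] at h5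
  nlinarith

omit [Fintype F] in
/-- If all relative shifts outside `G` produce more than `K` mismatches, then samples of `x` and `y`
that agree are taken, for most patterns, at positions that agree modulo `G`. -/
lemma isRare_sample_eq [DecidableEq F] {G : AddSubgroup Γ} {K : ℕ} {x y : Γ → F}
    (hG : ∀ i j, i - j ∉ G → K < hammingDist (advance i x) (advance j y))
    (hK : K < Fintype.card Γ →
      4 * Fintype.card Γ ^ 2 * (Fintype.card Γ - K) ^ w ≤ Fintype.card Γ ^ w) :
    IsRare 4 {W : Fin w → Γ | ∃ i j, i - j ∉ G ∧ sample W x i = sample W y j} := by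
  classical
  have hH (i j : Γ) : hammingDist (advance i x) (advance j y) ≤ Fintype.card Γ := by
    exact Finset.card_le_univ _
  -- If `K` is at least the length of the strings, then all differences of positions lie in `G`.
  by_cases hKn : K < Fintype.card Γ
  · have hsub : {W : Fin w → Γ | ∃ i j, i - j ∉ G ∧ sample W x i = sample W y j} ⊆
        ⋃ p ∈ {p : Γ × Γ | p.1 - p.2 ∉ G}, {W : Fin w → Γ | ∀ a, W a ∈
          {b : Γ | advance p.1 x b = advance p.2 y b}} := by
      rintro W ⟨i, j, hij, hW⟩
      refine Set.mem_biUnion (x := (i, j)) hij fun a => ?_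
      have := congrFun hW a
      simpa only [sample, advance, Set.mem_ofPred_eq, add_comm] using this
    refine IsRare.mono ?_ hsub
    have h1 := ncard_biUnion_mul_le (N := 1) (M := (Fintype.card Γ - K) ^ w)
      (Set.toFinite {p : Γ × Γ | p.1 - p.2 ∉ G})
      (fun p => {W : Fin w → Γ | ∀ a, W a ∈ {b : Γ | advance p.1 x b = advance p.2 y b}}) (by
        intro p hp
        rw [ncard_pi_const, mul_one]
        refine Nat.pow_le_pow_left ?_ w
        have h2 := Set.ncard_add_ncard_compl {b : Γ | advance p.1 x b = advance p.2 y b}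
        have h3 : ({b : Γ | advance p.1 x b = advance p.2 y b}ᶜ).ncard =
            hammingDist (advance p.1 x) (advance p.2 y) := by
          unfold hammingDist
          rw [← Set.ncard_coe_finset, Finset.coe_filter_univ]
          rfl
        rw [h3, Nat.card_eq_fintype_card] at h2
        have := hG _ _ hp
        omega)
    have h4 : {p : Γ × Γ | p.1 - p.2 ∉ G}.ncard ≤ Fintype.card Γ ^ 2 := by
      refine (Set.ncard_le_ncard (Set.subset_univ _) (Set.toFinite _)).trans ?_
      simp [Set.ncard_univ, Nat.card_eq_fintype_card, sq]
    have h5 := Nat.mul_le_mul_right ((Fintype.card Γ - K) ^ w) h4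
    have h6 := hK hKn
    unfold IsRare
    rw [Nat.card_fun, Nat.card_fin, Nat.card_eq_fintype_card]
    linarith
  · have hempty : {W : Fin w → Γ | ∃ i j, i - j ∉ G ∧ sample W x i = sample W y j} = ∅ := by
      refine Set.eq_empty_of_forall_notMem ?_
      rintro W ⟨i, j, hij, -⟩
      have := hG i j hij
      have := hH i j
      omega
    simp [IsRare, hempty]

/-- With probability at least one half, the anchors of `x` and of a shift of a string close to `x`
are consistent, modulo `G`, with the shift. -/
lemma isRare_anchor [DecidableEq F] [Nonempty Γ] {G : AddSubgroup Γ} {K k : ℕ} {x y : Γ → F} {m : Γ}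
    (h : hammingDist x (advance m y) ≤ k) (hw : 10 * k * w ≤ Fintype.card Γ)
    (hG : ∀ j ∉ G, K + k < hammingDist (advance j x) x)
    (hK : K < Fintype.card Γ →
      4 * Fintype.card Γ ^ 2 * (Fintype.card Γ - K) ^ w ≤ Fintype.card Γ ^ w) :
    IsRare 2 {p : (Fin w → Γ) × _ | anchor p.1 p.2 x - (anchor p.1 p.2 y - m) ∉ G} := by
  have hcross (i j : Γ) (hij : i - j ∉ G) :
      K < hammingDist (advance i x) (advance j (advance m y)) := by
    have h1 := hG _ hij
    have h2 := hammingDist_triangle (advance i x) (advance j (advance m y)) (advance j x)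
    rw [hammingDist_advance, hammingDist_comm _ x] at h2
    rw [← hammingDist_advance j, advance_advance, add_sub_cancel] at h1
    omega
  have h1 := (isRare_sample_eq hcross hK).fst (β := (Fin w → F) × Fin (Fintype.card Γ) ≃
      Fin (Fintype.card ((Fin w → F) × Fin (Fintype.card Γ))))
  have h2 : IsRare 5 {p : (Fin w → Γ) × _ | ¬∃ d, IsFirst p.2 (sampleSet p.1 x) d ∧
      IsFirst p.2 (sampleSet p.1 (advance m y)) d} :=
    IsRare.of_slices fun W => isRare_not_isFirst_sampleSet h hw W
  refine IsRare.mono (IsRare.union h1 (h2.of_le (by norm_num))) fun p hp => ?_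
  by_contra hgood
  simp only [Set.mem_union, Set.mem_ofPred_eq, not_or, not_not] at hgood
  obtain ⟨hW, d, hx, hy⟩ := hgood
  refine hW ⟨_, _, hp, ?_⟩
  rw [sampleSet_advance] at hy
  rw [sample_anchor hx, sample_advance, sub_add_cancel, sample_anchor hy]

end Anchor

/-! ### The sketch over a finite field -/

section Sketch

/-- The data sent for a string: for every level, the encoded group of approximate periods and
varying part; the anchors; and, for every level and anchor, the syndrome of the invariant part read
from the anchor on. -/
abbrev SketchData (Γ F : Type*) (l M ρ s : ℕ) : Type _ :=
  (Fin (2 * l) → (Fin l → Option Γ) × (Fin M → Option (Γ × Γ × F × F))) ×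
    (Fin ρ → Γ) × (Fin (2 * l) → Fin ρ → Fin s → F)

/-- The shared random choices: for every repetition a sampling pattern and an enumeration of the
possible samples, and a matrix that computes the syndromes. -/
abbrev Choices (Γ F : Type*) [Fintype Γ] [Fintype F] (w ρ s : ℕ) : Type _ :=
  (Fin ρ → (Fin w → Γ) × ((Fin w → F) × Fin (Fintype.card Γ) ≃
    Fin (Fintype.card ((Fin w → F) × Fin (Fintype.card Γ))))) × Matrix (Fin s) Γ F

/-- The output `t` is a correct answer to the `k`-mismatch problem for strings at distance `h`. -/
def IsCorrect (k h t : ℕ) : Prop :=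
  (h ≤ k → t = h) ∧ (k < h → k < t)

variable {Γ F : Type*} [AddCommGroup Γ] [Fintype Γ] [Field F] [Fintype F] [DecidableEq F]

/-- Level `r` and anchor `e` of two sketches fit together for the shift `m`, and `v` is a sparse
explanation of the difference of their syndromes. -/
def IsMatch {l M ρ s : ℕ} (k : ℕ)
    (D : Fin (2 * l) → (Fin l → Option Γ) × (Fin M → Option (Γ × Γ × F × F)) →
      AddSubgroup Γ × (Γ → F))
    (A : Matrix (Fin s) Γ F) (d₁ d₂ : SketchData Γ F l M ρ s) (m : Γ)
    (r : Fin (2 * l)) (e : Fin ρ) (v : Γ → F) : Prop :=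
  (D r (d₁.1 r)).1 = (D r (d₂.1 r)).1 ∧
  d₁.2.1 e - (d₂.2.1 e - m) ∈ (D r (d₁.1 r)).1 ∧
  IsCosetSparse (D r (d₁.1 r)).1 k v ∧
  A.mulVec v = d₁.2.2 r e - d₂.2.2 r e

open Classical in
/-- The decoder: any match yields the difference of the two strings; without a match, the distance
is declared to exceed `k`. -/
noncomputable def decode {l M ρ s : ℕ} (k : ℕ)
    (D : Fin (2 * l) → (Fin l → Option Γ) × (Fin M → Option (Γ × Γ × F × F)) →
      AddSubgroup Γ × (Γ → F))
    (A : Matrix (Fin s) Γ F) (d₁ d₂ : SketchData Γ F l M ρ s) (m : Γ) : ℕ :=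
  if h : ∃ t r e v, IsMatch k D A d₁ d₂ m r e v ∧
      t = hammingNorm (advance (-d₁.2.1 e) v + (D r (d₁.1 r)).2 - advance m (D r (d₂.1 r)).2)
    then h.choose else k + 1

/-- The encoder, for given encodings of the varying parts. -/
noncomputable def sketch {l M ρ s w : ℕ} (T : ℕ → ℕ)
    (E : Fin (2 * l) → (Γ → F) → (Fin l → Option Γ) × (Fin M → Option (Γ × Γ × F × F)))
    (ω : Choices Γ F w ρ s) (x : Γ → F) : SketchData Γ F l M ρ s :=
  (fun r => E r x, fun e => anchor (ω.1 e).1 (ω.1 e).2 x,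
    fun r e => ω.2.mulVec (advance (anchor (ω.1 e).1 (ω.1 e).2 x)
      (invariantPart (periodGroup (T r) x) x)))

omit [Fintype Γ] [Fintype F] [DecidableEq F] in
/-- If two anchors are consistent with the shift `m` modulo `G`, then the difference of the
invariant parts read from the anchors is that of the aligned strings. -/
lemma advance_sub_advance_eq {G : AddSubgroup Γ} {a b m : Γ} (h : a - (b - m) ∈ G) (x y : Γ → F) :
    advance a (invariantPart G x) - advance b (invariantPart G y) =
      invariantPart G (advance a x) - invariantPart G (advance a (advance m y)) := by
  rw [advance_advance, invariantPart_advance, invariantPart_advance]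
  congr 1
  funext i
  simp only [advance]
  rw [← invariantPart_add_mem G y h (i + b)]
  congr 1
  abel

/-- The sketch for strings over a finite field. It errs only if the matrix fails to tell one of the
actual differences of invariant parts from another sparse string, or if all anchors are inconsistent
with the shift at the level where the groups of approximate periods agree. -/
theorem exists_sketch_of_group {k w l K ρ s M : ℕ} (hl : Fintype.card Γ < 2 ^ l)
    (hw : 10 * k * w ≤ Fintype.card Γ)
    (hK : K < Fintype.card Γ →
      4 * Fintype.card Γ ^ 2 * (Fintype.card Γ - K) ^ w ≤ Fintype.card Γ ^ w)
    (hM : l * (K + k + 4 * k * l) ≤ M) :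
    ∃ (sk : Choices Γ F w ρ s → (Γ → F) → SketchData Γ F l M ρ s)
      (dec : Choices Γ F w ρ s → SketchData Γ F l M ρ s → SketchData Γ F l M ρ s → Γ → ℕ),
      ∀ N, 2 * N ≤ 2 ^ ρ →
        2 * N * (2 * l * Fintype.card Γ ^ 2 * (Fintype.card Γ * Fintype.card F + 1) ^ k) ≤
          Fintype.card F ^ s →
        ∀ x y m, IsRare N {ω | ¬IsCorrect k (hammingDist x (advance m y))
          (dec ω (sk ω x) (sk ω y) m)} := by
  classical
  obtain ⟨T, hT⟩ : ∃ T : ℕ → ℕ, ∀ r, T r = K + k + 2 * k * r := ⟨_, fun _ => rfl⟩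
  have hTM (r : Fin (2 * l)) : l * T r ≤ M := by
    refine le_trans (Nat.mul_le_mul_left l ?_) hM
    have := Nat.mul_le_mul_left (2 * k) r.2.le
    rw [hT]
    linarith
  choose E D hD using fun r => exists_encoding_varyingPart (F := F) hl (hTM r)
  refine ⟨sketch T E, fun ω => decode k D ω.2, fun N hρ hs x y m => ?_⟩
  let u (t : Fin (2 * l) × Γ × Γ) : Γ → F :=
    advance t.2.1 (invariantPart (periodGroup (T t.1) x) x) -
      advance t.2.2 (invariantPart (periodGroup (T t.1) x) y)
  have hbadA : IsRare (2 * N) {ω : Choices Γ F w ρ s | ω.2 ∈ {A : Matrix (Fin s) Γ F |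
      ∃ t v, IsCosetSparse (periodGroup (T t.1) x) k v ∧ A.mulVec v = A.mulVec (u t) ∧
        v ≠ u t}} := by
    refine IsRare.snd (isRare_mulVec_eq_mulVec _ _ ?_)
    simpa [sq, mul_assoc] using hs
  -- Unless the matrix fails, any match leads to the exact distance.
  have hsound : ∀ ω : Choices Γ F w ρ s,
      (¬∃ t v, IsCosetSparse (periodGroup (T t.1) x) k v ∧ ω.2.mulVec v = ω.2.mulVec (u t) ∧
        v ≠ u t) → ∀ r e v, IsMatch k D ω.2 (sketch T E ω x) (sketch T E ω y) m r e v →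
      hammingNorm (advance (-(sketch T E ω x).2.1 e) v + (D r ((sketch T E ω x).1 r)).2 -
        advance m (D r ((sketch T E ω y).1 r)).2) = hammingDist x (advance m y) := by
    intro ω hω r e v hv
    obtain ⟨hG, ha, hsp, hA⟩ := hv
    simp only [sketch, hD] at hG ha hsp hA ⊢
    set a := anchor (ω.1 e).1 (ω.1 e).2 x
    set b := anchor (ω.1 e).1 (ω.1 e).2 y
    have hvu : v = u (r, a, b) := by
      by_contra hne
      refine hω ⟨(r, a, b), v, hsp, ?_, hne⟩
      rw [hA, ← Matrix.mulVec_sub]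
      simp only [u]
      rw [← hG]
    rw [hammingDist_comm, hammingDist_eq_hammingNorm, hvu]
    congr 1
    simp only [u]
    rw [advance_sub_advance_eq ha, invariantPart_advance, invariantPart_advance, ← hG,
      ← varyingPart_advance]
    funext i
    simp only [varyingPart, advance, invariantPart_advance, Pi.add_apply, Pi.sub_apply,
      Pi.neg_apply, neg_add_cancel_right]
    ring
  by_cases hd : hammingDist x (advance m y) ≤ k
  · obtain ⟨r, hr, hrG⟩ := exists_periodGroup_eq (K + k) hd hl
    rw [periodGroup_advance, ← hT] at hrG
    have hanchor := ((isRare_anchor (w := w) (G := periodGroup (T r) x) hd hw (fun j hj =>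
      lt_of_le_of_lt (by rw [hT]; omega) (lt_hammingDist_of_notMem_periodGroup hj)) hK).pi_const ρ).fst
      (β := Matrix (Fin s) Γ F)
    refine IsRare.mono (IsRare.union (hanchor.of_le hρ) hbadA) fun ω hω => ?_
    by_contra hgood
    simp only [Set.mem_union, Set.mem_ofPred_eq, not_or, not_forall, not_not] at hgood
    obtain ⟨⟨e, he⟩, hA⟩ := hgood
    have hmatch : ∃ t r e v, IsMatch k D ω.2 (sketch T E ω x) (sketch T E ω y) m r e v ∧
        t = hammingNorm (advance (-(sketch T E ω x).2.1 e) v + (D r ((sketch T E ω x).1 r)).2 -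
          advance m (D r ((sketch T E ω y).1 r)).2) := by
      refine ⟨_, ⟨r, hr⟩, e,
        u (⟨r, hr⟩, anchor (ω.1 e).1 (ω.1 e).2 x, anchor (ω.1 e).1 (ω.1 e).2 y),
        ⟨?_, ?_, ?_, ?_⟩, rfl⟩
      · simpa only [sketch, hD] using hrG
      · simpa only [sketch, hD] using he
      · simp only [sketch, hD, u]
        rw [advance_sub_advance_eq he]
        exact isCosetSparse_invariantPart_sub _ (by rwa [hammingDist_advance])
      · simp only [sketch, u]
        rw [← Matrix.mulVec_sub, hrG]
    refine hω ?_
    have hval : decode k D ω.2 (sketch T E ω x) (sketch T E ω y) m =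
        hammingDist x (advance m y) := by
      unfold decode
      rw [dif_pos hmatch]
      obtain ⟨r', e', v', hm, ht⟩ := hmatch.choose_spec
      rw [ht, hsound ω hA r' e' v' hm]
    exact ⟨fun _ => hval, fun h => absurd h (not_lt.mpr hd)⟩
  · refine IsRare.mono (hbadA.of_le (by omega)) fun ω hω => ?_
    by_contra hA
    refine hω ⟨fun h => absurd h hd, fun h => ?_⟩
    change k < decode k D ω.2 (sketch T E ω x) (sketch T E ω y) m
    unfold decode
    split_ifs with hmatch
    · obtain ⟨r', e', v', hm, ht⟩ := hmatch.choose_spec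
      rw [ht, hsound ω hA r' e' v' hm]
      exact h
    · exact Nat.lt_succ_self k

end Sketch

/-! ### Parameters and encoding into bits -/

/-- With the sampling rate `1 / (10 k)`, two strings at distance more than `40 k (log n + 1)` have
equal samples with probability at most `1 / (4 n ^ 2)`. -/
lemma four_mul_sq_mul_sub_pow_le {n k l : ℕ} (hk : 1 ≤ k) (hl : n < 2 ^ l)
    (hn : 40 * k * (l + 1) < n) :
    4 * n ^ 2 * (n - 40 * k * (l + 1)) ^ (n / (10 * k)) ≤ n ^ (n / (10 * k)) := by
  set w := n / (10 * k) with hw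
  have hw1 : 1 ≤ w := by
    rw [hw, Nat.one_le_div_iff (by omega)]
    nlinarith
  have hw2 : n ≤ 20 * k * w := by
    have h1 : n < 10 * k * (w + 1) := Nat.lt_mul_div_succ n (by omega)
    have h2 : 10 * k * 1 ≤ 10 * k * w := Nat.mul_le_mul_left _ hw1
    linarith
  have hn0 : (0 : ℝ) < n := by
    exact_mod_cast (by omega : 0 < n)
  have hexp : (1 - (40 * k * (l + 1) : ℕ) / (n : ℝ)) ^ w ≤ (1 / 2) ^ (2 * (l + 1)) := by
    have h0 : (0 : ℝ) ≤ 1 - (40 * k * (l + 1) : ℕ) / (n : ℝ) := by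
      rw [sub_nonneg, div_le_one hn0]
      exact_mod_cast hn.le
    calc (1 - (40 * k * (l + 1) : ℕ) / (n : ℝ)) ^ w
        ≤ Real.exp (-((40 * k * (l + 1) : ℕ) / (n : ℝ))) ^ w :=
          pow_le_pow_left₀ h0 (Real.one_sub_le_exp_neg _) w
      _ = Real.exp (-((40 * k * (l + 1) : ℕ) / (n : ℝ) * w)) := by
          rw [← Real.exp_nat_mul]
          congr 1
          ring
      _ ≤ Real.exp (-(2 * (l + 1) : ℕ)) := by
          refine Real.exp_le_exp.mpr (neg_le_neg ?_)
          rw [div_mul_eq_mul_div, le_div_iff₀ hn0]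
          have := Nat.mul_le_mul_left (2 * (l + 1)) hw2
          exact_mod_cast (by linarith : 2 * (l + 1) * n ≤ 40 * k * (l + 1) * w)
      _ = Real.exp (-1) ^ (2 * (l + 1)) := by
          rw [← Real.exp_nat_mul]
          congr 1
          ring
      _ ≤ (1 / 2) ^ (2 * (l + 1)) := by
          refine pow_le_pow_left₀ (Real.exp_pos _).le ?_ _
          rw [Real.exp_neg, one_div]
          exact inv_anti₀ (by norm_num) (by linarith [Real.add_one_le_exp (1 : ℝ)])
  have hsq : (4 : ℝ) * (n : ℝ) ^ 2 * (1 / 2) ^ (2 * (l + 1)) ≤ 1 := by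
    have h1 : (n : ℝ) ≤ 2 ^ l := by exact_mod_cast hl.le
    have h2 : (n : ℝ) ^ 2 ≤ (2 ^ l) ^ 2 := pow_le_pow_left₀ hn0.le h1 2
    rw [one_div, inv_pow, ← div_eq_mul_inv, div_le_one (by positivity)]
    calc (4 : ℝ) * (n : ℝ) ^ 2 ≤ 4 * (2 ^ l) ^ 2 := by linarith
      _ = 2 ^ (2 * (l + 1)) := by ring
  have hreal : (4 : ℝ) * (n : ℝ) ^ 2 * ((n : ℝ) - (40 * k * (l + 1) : ℕ)) ^ w ≤ (n : ℝ) ^ w := by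
    have h1 : (n : ℝ) - (40 * k * (l + 1) : ℕ) = n * (1 - (40 * k * (l + 1) : ℕ) / (n : ℝ)) := by
      field_simp
    rw [h1, mul_pow]
    calc _ = (n : ℝ) ^ w *
          (4 * (n : ℝ) ^ 2 * (1 - (40 * k * (l + 1) : ℕ) / (n : ℝ)) ^ w) := by ring
      _ ≤ (n : ℝ) ^ w * 1 := by
          refine mul_le_mul_of_nonneg_left (le_trans ?_ hsq) (by positivity)
          exact mul_le_mul_of_nonneg_left hexp (by positivity)
      _ = _ := mul_one _
  rw [← Nat.cast_sub hn.le] at hreal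
  exact_mod_cast hreal

lemma card_sketchData_le {Γ F : Type*} [Fintype Γ] [Fintype F] {l M ρ s b : ℕ}
    (hΓ : Fintype.card Γ + 1 ≤ 2 ^ b) (hF : Fintype.card F ≤ 2 ^ b)
    (hΓF : (Fintype.card Γ * Fintype.card F) ^ 2 + 1 ≤ 2 ^ b) :
    Fintype.card (SketchData Γ F l M ρ s) ≤ 2 ^ (b * (2 * l * (l + M) + ρ + 2 * l * ρ * s)) := by
  have h1 : Fintype.card Γ * (Fintype.card Γ * (Fintype.card F * Fintype.card F)) + 1 ≤ 2 ^ b := by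
    refine le_of_eq_of_le ?_ hΓF
    ring
  simp only [SketchData, Fintype.card_prod, Fintype.card_fun, Fintype.card_option, Fintype.card_fin]
  calc _ ≤ ((2 ^ b) ^ l * (2 ^ b) ^ M) ^ (2 * l) *
        ((2 ^ b) ^ ρ * (((2 ^ b) ^ s) ^ ρ) ^ (2 * l)) := by
        gcongr
        omega
    _ = _ := by
        simp only [← pow_mul, ← pow_add]
        congr 1
        ring

lemma exists_injective_bits {D : Type*} {_ : Fintype D} {B : ℕ} (h : Fintype.card D ≤ 2 ^ B) :
    ∃ f : D → List Bool, Function.Injective f ∧ ∀ d, (f d).length = B := by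
  obtain ⟨g⟩ := Function.Embedding.nonempty_of_card_le (α := D) (β := Fin B → Bool) (by simpa using h)
  exact ⟨fun d => List.ofFn (g d), List.ofFn_injective.comp g.injective, fun d => List.length_ofFn⟩

lemma natLog_add_one_le (n : ℕ) (hn : 1 ≤ n) :
    ((Nat.log 2 n + 1 : ℕ) : ℝ) ≤ 2 * (1 + Real.log n) := by
  have h1 : (2 : ℝ) ^ Nat.log 2 n ≤ n := by
    exact_mod_cast Nat.pow_log_le_self 2 (by omega)
  have h2 := Real.log_le_log (by positivity) h1
  rw [Real.log_pow] at h2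
  have h3 := Real.log_two_gt_d9
  have h4 : (0 : ℝ) ≤ Nat.log 2 n := Nat.cast_nonneg _
  push_cast
  nlinarith

lemma sketch_length_le {c k l : ℕ} (hk : 1 ≤ k) (hl : 1 ≤ l) :
    (2 * c + 11) * l *
      (2 * l * (l + 85 * k * l ^ 2) + (c * l + 2) + 2 * l * (c * l + 2) * (2 * k + 3)) ≤
    (2 * c + 11) * (11 * c + 194) * k * l ^ 4 := by
  have hl2 : l ≤ k * l ^ 2 := by nlinarith
  have hl3 : l ^ 2 ≤ l ^ 3 := Nat.pow_le_pow_right hl (by norm_num)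
  have hρ : c * l + 2 ≤ (c + 2) * l := by nlinarith
  have h1 : c * l + 2 ≤ (c + 2) * k * l ^ 3 :=
    calc c * l + 2 ≤ (c + 2) * l := hρ
      _ ≤ (c + 2) * (k * l ^ 2) := Nat.mul_le_mul_left _ hl2
      _ = (c + 2) * k * l ^ 2 := by ring
      _ ≤ (c + 2) * k * l ^ 3 := Nat.mul_le_mul_left _ hl3
  have h2 : 2 * l * (c * l + 2) * (2 * k + 3) ≤ 10 * (c + 2) * k * l ^ 3 :=
    calc 2 * l * (c * l + 2) * (2 * k + 3) ≤ 2 * l * ((c + 2) * l) * (5 * k) :=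
          Nat.mul_le_mul (Nat.mul_le_mul_left _ hρ) (by omega)
      _ = 10 * (c + 2) * k * l ^ 2 := by ring
      _ ≤ 10 * (c + 2) * k * l ^ 3 := Nat.mul_le_mul_left _ hl3
  have h3 : 2 * l * (l + 85 * k * l ^ 2) ≤ 172 * k * l ^ 3 :=
    calc 2 * l * (l + 85 * k * l ^ 2) ≤ 2 * l * (k * l ^ 2 + 85 * k * l ^ 2) :=
          Nat.mul_le_mul_left _ (Nat.add_le_add_right hl2 _)
      _ = 172 * k * l ^ 3 := by ring
  calc _ ≤ (2 * c + 11) * l *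
        (172 * k * l ^ 3 + (c + 2) * k * l ^ 3 + 10 * (c + 2) * k * l ^ 3) := by gcongr
    _ = _ := by ring

/-- The number of rows `2 k + 3` makes up for all differences that are sparse in cosets. -/
lemma syndrome_size_bound {c k l N q : ℕ} (hlN : l ≤ N) (hN : 1 ≤ N) (hq : 4 * N ^ (c + 1) < q) :
    2 * (2 * N ^ c) * (2 * l * N ^ 2 * (N * q + 1) ^ k) ≤ q ^ (2 * k + 3) := by
  have hNN : N ≤ N ^ (c + 1) := Nat.le_self_pow (by omega) N
  have h1 : N * q + 1 ≤ q ^ 2 := by nlinarith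
  have h2 : (N * q + 1) ^ k ≤ q ^ (2 * k) := by
    rw [pow_mul]
    exact Nat.pow_le_pow_left h1 k
  have h3 : 2 * (2 * N ^ c) * (2 * l * N ^ 2) ≤ q ^ 3 := by
    calc _ ≤ 2 * (2 * N ^ c) * (2 * N * N ^ 2) := by gcongr
      _ = 8 * N ^ (c + 1) * N * N := by ring
      _ ≤ 8 * N ^ (c + 1) * N ^ (c + 1) * N ^ (c + 1) := by gcongr
      _ = 8 * (N ^ (c + 1)) ^ 3 := by ring
      _ ≤ 64 * (N ^ (c + 1)) ^ 3 := Nat.mul_le_mul_right _ (by norm_num)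
      _ = (4 * N ^ (c + 1)) ^ 3 := by ring
      _ ≤ q ^ 3 := Nat.pow_le_pow_left hq.le 3
  calc _ = 2 * (2 * N ^ c) * (2 * l * N ^ 2) * (N * q + 1) ^ k := by ring
    _ ≤ q ^ 3 * q ^ (2 * k) := Nat.mul_le_mul h3 h2
    _ = q ^ (2 * k + 3) := by rw [← pow_add, add_comm]

/-- The letters, the positions and the recorded changes each fit into `(2 c + 11) l` bits. -/
lemma le_two_pow_bits {c l N q : ℕ} (hNl : N < 2 ^ l) (hl : 1 ≤ l)
    (hq : q ≤ 2 * (4 * N ^ (c + 1))) :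
    q ≤ 2 ^ ((2 * c + 11) * l) ∧ N + 1 ≤ 2 ^ ((2 * c + 11) * l) ∧
      (N * q) ^ 2 + 1 ≤ 2 ^ ((2 * c + 11) * l) := by
  have hq3 : q ≤ 2 ^ ((c + 1) * l + 3) := by
    have := Nat.pow_le_pow_left hNl.le (c + 1)
    rw [← pow_mul, mul_comm l] at this
    rw [pow_add]
    omega
  refine ⟨hq3.trans (Nat.pow_le_pow_right (by norm_num) (by nlinarith)),
    le_trans hNl (Nat.pow_le_pow_right (by norm_num) (by nlinarith)), ?_⟩
  have h1 : (N * q) ^ 2 ≤ 2 ^ (2 * (l + ((c + 1) * l + 3))) := by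
    rw [mul_comm 2, pow_mul, pow_add]
    exact Nat.pow_le_pow_left (Nat.mul_le_mul hNl.le hq3) 2
  have h2 : 1 ≤ 2 ^ (2 * (l + ((c + 1) * l + 3))) := Nat.one_le_two_pow
  have h3 : 2 ^ (2 * (l + ((c + 1) * l + 3)) + 1) ≤ 2 ^ ((2 * c + 11) * l) :=
    Nat.pow_le_pow_right (by norm_num) (by nlinarith)
  rw [pow_succ] at h3
  omega

/-! ### The sketch over an arbitrary alphabet -/

/-- Random relabelling of the letters preserves a given Hamming distance with high probability. -/
lemma isRare_hammingDist_comp_ne {Γ α F : Type*} [Fintype Γ] [Nonempty Γ] [Fintype α]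
    [DecidableEq α] [AddCommGroup F] [Fintype F] [DecidableEq F] {N : ℕ}
    (hN : N * Fintype.card Γ ≤ Fintype.card F) (x y : Γ → α) :
    IsRare N {h : α → F | hammingDist (h ∘ x) (h ∘ y) ≠ hammingDist x y} := by
  classical
  have hsub : {h : α → F | hammingDist (h ∘ x) (h ∘ y) ≠ hammingDist x y} ⊆
      ⋃ i ∈ {i | x i ≠ y i}, {h : α → F | h (x i) = h (y i)} := by
    intro h hh
    by_contra hno
    simp only [Set.mem_iUnion, not_exists] at hno
    refine hh ?_
    unfold hammingDist
    congr 1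
    refine Finset.filter_congr fun i _ => not_congr ⟨fun he => ?_, fun he => congrArg h he⟩
    by_contra hne
    exact hno i hne he
  refine IsRare.mono ?_ hsub
  have h1 := ncard_biUnion_mul_le (Set.toFinite {i | x i ≠ y i})
    (fun i => {h : α → F | h (x i) = h (y i)}) (fun i hi => isRare_apply_eq (F := F) hi)
  have h2 : {i | x i ≠ y i}.ncard ≤ Fintype.card Γ := by
    rw [← Nat.card_eq_fintype_card, ← Set.ncard_univ]
    exact Set.ncard_le_ncard (Set.subset_univ _) (Set.toFinite _)
  rw [Nat.card_eq_fintype_card (α := F)] at h1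
  refine Nat.le_of_mul_le_mul_right (c := Fintype.card Γ) ?_ Fintype.card_pos
  set X := (⋃ i ∈ {i | x i ≠ y i}, {h : α → F | h (x i) = h (y i)}).ncard
  calc X * N * Fintype.card Γ = X * (N * Fintype.card Γ) := by ring
    _ ≤ X * Fintype.card F := Nat.mul_le_mul_left _ hN
    _ ≤ _ := h1
    _ ≤ Fintype.card Γ * Nat.card (α → F) := Nat.mul_le_mul_right _ h2
    _ = _ := mul_comm _ _

lemma one_sub_le_real_of_isRare {Ω : Type} [Fintype Ω] [Nonempty Ω] [MeasurableSpace Ω]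
    [MeasurableSingletonClass Ω] {N : ℕ} (hN : 0 < N) {G : Set Ω} (h : IsRare N Gᶜ) :
    1 - 1 / (N : ℝ) ≤ (PMF.uniformOfFintype Ω).toMeasure.real G := by
  classical
  have hG : (PMF.uniformOfFintype Ω).toMeasure.real G = G.ncard / Nat.card Ω := by
    rw [Measure.real, PMF.toMeasure_uniformOfFintype_apply,
      ENNReal.toReal_div, ← Nat.card_eq_fintype_card, ← Nat.card_eq_fintype_card]
    · rfl
    · exact (Set.toFinite G).measurableSet
  have h1 : (G.ncard : ℝ) + (Gᶜ).ncard = Nat.card Ω := by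
    exact_mod_cast Set.ncard_add_ncard_compl G
  have h2 : ((Gᶜ).ncard : ℝ) * N ≤ Nat.card Ω := by exact_mod_cast h
  have hΩ : (0 : ℝ) < Nat.card Ω := by exact_mod_cast Nat.card_pos
  have hN' : (0 : ℝ) < N := by exact_mod_cast hN
  rw [hG, le_div_iff₀ hΩ, sub_mul, one_mul, div_mul_eq_mul_div, one_mul, sub_le_iff_le_add]
  have h3 : ((Gᶜ).ncard : ℝ) ≤ Nat.card Ω / N := by rwa [le_div_iff₀ hN']
  linarith

lemma cyc_zpow_apply (n σ : ℕ) (m : ℤ) (S : Str (n + 1) σ) :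
    (cyc (n + 1) σ ^ m) S = advance (m • (1 : Fin (n + 1))) S := by
  have hcyc (T : Str (n + 1) σ) : cyc (n + 1) σ T = advance 1 T := by
    funext i
    simp [cyc, advance]
  have hinv (T : Str (n + 1) σ) : (cyc (n + 1) σ)⁻¹ T = advance (-1) T := by
    rw [Equiv.Perm.inv_eq_iff_eq, hcyc, advance_advance, add_neg_cancel, advance_zero]
  induction m using Int.induction_on with
  | zero => simp [advance_zero]
  | succ i ih =>
    rw [add_comm (i : ℤ), zpow_add, zpow_one, Equiv.Perm.mul_apply, ih, hcyc, advance_advance, add_zsmul,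
      one_zsmul]
  | pred i ih =>
    rw [sub_eq_add_neg, add_comm (-(i : ℤ)), zpow_add, zpow_neg_one, Equiv.Perm.mul_apply, ih, hinv,
      advance_advance, add_zsmul, neg_one_zsmul]

/-- A sketch for strings over a large finite field yields, after a random relabelling of the letters,
a sketch by bit strings for strings over an arbitrary alphabet. -/
lemma exists_bits_of_sketch {R D F : Type} [Fintype R] [Nonempty R] {_ : Fintype D}
    [AddCommGroup F] [Fintype F] [DecidableEq F] {n k σ N B : ℕ}
    {sk : R → (Fin (n + 1) → F) → D} {dec : R → D → D → Fin (n + 1) → ℕ}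
    (hD : Fintype.card D ≤ 2 ^ B) (hF : 2 * N * (n + 1) ≤ Fintype.card F)
    (hsk : ∀ x y m, IsRare (2 * N) {ω | ¬IsCorrect k (hammingDist x (advance m y))
      (dec ω (sk ω x) (sk ω y) m)}) :
    ∃ (Ω : Type) (_ : Fintype Ω) (_ : Nonempty Ω) (sk : Ω → Str (n + 1) σ → List Bool)
      (dec : Ω → List Bool → List Bool → ℤ → ℕ),
      (∀ ω S, (sk ω S).length = B) ∧
      ∀ S₁ S₂ m, IsRare N
        {ω | ¬IsCorrect k (hamShift S₁ S₂ m) (dec ω (sk ω S₁) (sk ω S₂) m)} := by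
  classical
  obtain ⟨code, hcode, hlen⟩ := exists_injective_bits hD
  have hneD : Nonempty D := ⟨sk (Classical.arbitrary R) 0⟩
  let sk' (ω : (Fin σ → F) × R) (S : Str (n + 1) σ) : List Bool := code (sk ω.2 (ω.1 ∘ S))
  let dec' (ω : (Fin σ → F) × R) (L₁ L₂ : List Bool) (m : ℤ) : ℕ :=
    dec ω.2 (Function.invFun code L₁) (Function.invFun code L₂) (m • (1 : Fin (n + 1)))
  refine ⟨(Fin σ → F) × R, inferInstance, inferInstance, sk', dec', fun ω S => hlen _, ?_⟩
  intro S₁ S₂ m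
  have hhash : IsRare (2 * N) {h : Fin σ → F |
      hammingDist (h ∘ S₁) (h ∘ advance (m • (1 : Fin (n + 1))) S₂) ≠
        hammingDist S₁ (advance (m • (1 : Fin (n + 1))) S₂)} :=
    isRare_hammingDist_comp_ne (by rwa [Fintype.card_fin]) _ _
  have hsketch : IsRare (2 * N) {ω : (Fin σ → F) × R |
      ¬IsCorrect k (hammingDist (ω.1 ∘ S₁) (advance (m • (1 : Fin (n + 1))) (ω.1 ∘ S₂)))
        (dec ω.2 (sk ω.2 (ω.1 ∘ S₁)) (sk ω.2 (ω.1 ∘ S₂)) (m • (1 : Fin (n + 1))))} :=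
    IsRare.of_slices fun h => hsk (h ∘ S₁) (h ∘ S₂) (m • (1 : Fin (n + 1)))
  have hunion := (hhash.fst (β := R)).union hsketch
  refine hunion.mono fun ω hω => ?_
  by_contra hgood
  simp only [Set.mem_union, Set.mem_ofPred_eq, not_or, not_not] at hgood
  refine hω ?_
  simp only [sk', dec', Function.leftInverse_invFun hcode _]
  rw [hamShift, cyc_zpow_apply, ← hgood.1]
  exact hgood.2

/-- The sketch by bit strings, with probabilities expressed by counting the choices of a finite
probability space. -/
lemma exists_sketch_bits (c n k σ : ℕ) (hk : 1 ≤ k) :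
    ∃ (Ω : Type) (_ : Fintype Ω) (_ : Nonempty Ω) (sk : Ω → Str (n + 1) σ → List Bool)
      (dec : Ω → List Bool → List Bool → ℤ → ℕ),
      (∀ ω S, (sk ω S).length ≤
        (2 * c + 11) * (11 * c + 194) * k * (Nat.log 2 (n + 1) + 1) ^ 4) ∧
      ∀ S₁ S₂ m, IsRare ((n + 1) ^ c)
        {ω | ¬IsCorrect k (hamShift S₁ S₂ m) (dec ω (sk ω S₁) (sk ω S₂) m)} := by
  -- The logarithmic unit of all parameters: the least `l` with `n + 1 < 2 ^ l`.
  set l := Nat.log 2 (n + 1) + 1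
  have hNl : n + 1 < 2 ^ l := Nat.lt_pow_succ_log_self (by norm_num) (n + 1)
  have hl1 : 1 ≤ l := Nat.succ_pos _
  have hlN : l ≤ n + 1 := Nat.log_lt_self 2 (by omega)
  -- The field is large enough for the relabelled letters of two strings not to collide.
  obtain ⟨q, hqp, hq1, hq2⟩ :=
    Nat.exists_prime_lt_and_le_two_mul (4 * (n + 1) ^ (c + 1)) (by positivity)
  have : Fact q.Prime := ⟨hqp⟩
  have hM : l * (40 * k * (l + 1) + k + 4 * k * l) ≤ 85 * k * l ^ 2 := by
    have h2 : 44 * l * l + 41 * l ≤ 85 * l ^ 2 := by nlinarith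
    calc l * (40 * k * (l + 1) + k + 4 * k * l) = k * (44 * l * l + 41 * l) := by ring
      _ ≤ k * (85 * l ^ 2) := Nat.mul_le_mul_left k h2
      _ = 85 * k * l ^ 2 := by ring
  obtain ⟨sk, dec, hsk⟩ := exists_sketch_of_group (Γ := Fin (n + 1)) (F := ZMod q) (k := k)
    (w := (n + 1) / (10 * k)) (l := l) (K := 40 * k * (l + 1)) (ρ := c * l + 2) (s := 2 * k + 3)
    (by rwa [Fintype.card_fin])
    (by rw [Fintype.card_fin]; exact Nat.mul_div_le (n + 1) (10 * k))
    (by rw [Fintype.card_fin]; exact four_mul_sq_mul_sub_pow_le hk hNl) hM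
  -- Each repetition fails with probability at most one half, so `c * l + 2` of them suffice.
  have hρ : 2 * (2 * (n + 1) ^ c) ≤ 2 ^ (c * l + 2) := by
    have := Nat.pow_le_pow_left hNl.le c
    rw [← pow_mul, mul_comm l] at this
    rw [pow_add]
    omega
  have hs := syndrome_size_bound (k := k) hlN (by omega) hq1
  obtain ⟨hqb, hNb, hNqb⟩ := le_two_pow_bits hNl hl1 hq2
  have hcard := card_sketchData_le (Γ := Fin (n + 1)) (F := ZMod q) (l := l) (M := 85 * k * l ^ 2)
    (ρ := c * l + 2) (s := 2 * k + 3) (by rwa [Fintype.card_fin]) (by rwa [ZMod.card])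
    (by rwa [Fintype.card_fin, ZMod.card])
  have hne : Nonempty
      (Choices (Fin (n + 1)) (ZMod q) ((n + 1) / (10 * k)) (c * l + 2) (2 * k + 3)) :=
    ⟨(fun _ => (fun _ => 0, Fintype.equivFin _), 0)⟩
  obtain ⟨Ω, _, _, sk', dec', hlen, hdec⟩ := exists_bits_of_sketch (σ := σ) hcard
    (by rw [ZMod.card, mul_assoc, ← pow_succ]; omega)
    (hsk (2 * (n + 1) ^ c) hρ (by rwa [Fintype.card_fin, ZMod.card]))
  exact ⟨Ω, inferInstance, inferInstance, sk', dec', fun ω S => (hlen ω S).trans_le (sketch_length_le hk hl1), hdec⟩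

theorem mainTheorem1 :
    ∀ c : ℕ, ∃ (C : ℝ) (d : ℕ), ∀ (n k σ : ℕ), 1 ≤ n → k ≤ n →
      ∃ (Ω : Type) (_ : MeasurableSpace Ω) (P : Measure Ω) (_ : IsProbabilityMeasure P)
        (sk : Ω → Str n σ → List Bool) (dec : Ω → List Bool × List Bool × ℤ → ℕ),
        IsExactCircularSketch P k (1 / (n : ℝ) ^ c) sk dec ∧
        HasSketchSize P (C * (max k 1 : ℕ) * (1 + Real.log n) ^ d) (1 / (n : ℝ) ^ c) sk := by
  intro c
  -- The factor `2 ^ 4` converts the fourth power of `Nat.log 2 n + 1` into that of `1 + log n`.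
  refine ⟨(2 * c + 11) * (11 * c + 194) * 2 ^ 4, 4, fun n k σ hn _ => ?_⟩
  obtain ⟨n, rfl⟩ : ∃ n', n = n' + 1 := ⟨n - 1, by omega⟩
  -- For `k = 0` the sketch for one mismatch also serves, since it reports the exact distance.
  obtain ⟨Ω, _, _, sk, dec, hlen, hdec⟩ := exists_sketch_bits c n (max k 1) σ (le_max_right k 1)
  let _ : MeasurableSpace Ω := ⊤
  have hpos : 0 < (n + 1) ^ c := by positivity
  refine ⟨Ω, ⊤, (PMF.uniformOfFintype Ω).toMeasure, inferInstance, sk,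
    fun ω p => dec ω p.1 p.2.1 p.2.2, ⟨fun _ _ => trivial, fun _ _ => trivial, fun S₁ S₂ m => ?_⟩,
    fun S => ?_⟩
  · have h := one_sub_le_real_of_isRare hpos (G := {ω |
      (hamShift S₁ S₂ m ≤ k → dec ω (sk ω S₁) (sk ω S₂) m = hamShift S₁ S₂ m) ∧
      (k < hamShift S₁ S₂ m → k < dec ω (sk ω S₁) (sk ω S₂) m)}) (by
      refine (hdec S₁ S₂ m).mono fun ω hω hgood => hω ⟨fun h => ?_, fun h => ?_⟩
      · exact hgood.1 (h.trans (le_max_left k 1))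
      · by_cases hk : hamShift S₁ S₂ m ≤ max k 1
        · rwa [hgood.1 hk]
        · exact (le_max_left k 1).trans_lt (hgood.2 (not_le.mp hk)))
    exact_mod_cast h
  · have hall : {ω | ((sk ω S).length : ℝ) ≤ (2 * c + 11) * (11 * c + 194) * 2 ^ 4 *
        (max k 1 : ℕ) * (1 + Real.log (n + 1 : ℕ)) ^ 4} = Set.univ := by
      refine Set.eq_univ_of_forall fun ω => ?_
      have h1 : ((sk ω S).length : ℝ) ≤ (2 * c + 11) * (11 * c + 194) * (max k 1 : ℕ) *
          ((Nat.log 2 (n + 1) + 1 : ℕ) : ℝ) ^ 4 := by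
        exact_mod_cast hlen ω S
      have h2 := pow_le_pow_left₀ (Nat.cast_nonneg _) (natLog_add_one_le (n + 1) hn) 4
      refine h1.trans ((mul_le_mul_of_nonneg_left h2 (by positivity)).trans_eq ?_)
      ring
    rw [hall, probReal_univ]
    have : (0 : ℝ) ≤ 1 / ((n + 1 : ℕ) : ℝ) ^ c := by positivity
    linarith
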